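/- For a finite simple graph $G$ write $v(G)$ and $e(G)$ for its numbers of vertices and edges, and let \[ m(G)=\max\left\{\frac{e(J)}{v(J)} : J\subseteq G,\ v(J)\ge 1\right\} \] be its maximum density. An edge colouring of $G$ is proper if any two distinct edges sharing a vertex receive different colours, and a copy of the $\ell$-vertex cycle $C_\ell$ in $G$ is rainbow if its edges have pairwise distinct colours. Let $\ell\ge 5$ be an integer and let $G$ be a finite simple graph with \[ m(G)<\frac{\ell-1}{\ell-2}. \] Then $G$ has a proper edge colouring (with any number of colours) that contains no rainbow copy of $C_\ell$; that is, $G$ does not have the anti-Ramsey property that every proper edge colouring of $G$ contains a rainbow copy of $C_\ell$. -/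

import Mathlib

namespace SimpleGraph

/-- The maximum density `m(G) = max { e(J) / v(J) : J ⊆ G, v(J) ≥ 1 }` of a finite graph `G`,
where `J` runs over all (not necessarily induced) subgraphs with at least one vertex.
For a finite nonempty vertex type the supremum is a maximum, see `isGreatest_maxDensity`. -/
noncomputable def maxDensity {V : Type*} (G : SimpleGraph V) : ℝ :=
  sSup {d : ℝ | ∃ J : G.Subgraph, 1 ≤ J.verts.ncard ∧
    d = (J.edgeSet.ncard : ℝ) / (J.verts.ncard : ℝ)}

theorem isGreatest_maxDensity {V : Type*} [Finite V] [Nonempty V] (G : SimpleGraph V) :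
    IsGreatest {d : ℝ | ∃ J : G.Subgraph, 1 ≤ J.verts.ncard ∧
      d = (J.edgeSet.ncard : ℝ) / (J.verts.ncard : ℝ)} G.maxDensity := by
  set S := {d : ℝ | ∃ J : G.Subgraph, 1 ≤ J.verts.ncard ∧
      d = (J.edgeSet.ncard : ℝ) / (J.verts.ncard : ℝ)} with hS
  have hfin : S.Finite := by
    refine (Set.finite_range
      (fun J : G.Subgraph => (J.edgeSet.ncard : ℝ) / (J.verts.ncard : ℝ))).subset ?_
    rintro d ⟨J, -, rfl⟩
    exact ⟨J, rfl⟩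
  have hne : S.Nonempty := by
    refine ⟨_, (⊤ : G.Subgraph), ?_, rfl⟩
    refine (Set.ncard_pos (Set.toFinite _)).2 ?_
    simp
  exact ⟨hne.csSup_mem hfin, fun d hd => le_csSup hfin.bddAbove hd⟩

/-- An edge colouring is proper if distinct edges sharing a vertex get different colours. -/
def EdgeLabeling.IsProper {V K : Type*} {G : SimpleGraph V} (c : G.EdgeLabeling K) : Prop :=
  ∀ e f : G.edgeSet, e ≠ f → (∃ v : V, v ∈ (e : Sym2 V) ∧ v ∈ (f : Sym2 V)) → c e ≠ c f

/-- A copy of `H` in `G` is rainbow for an edge colouring of `G` if all its edges have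
pairwise distinct colours. -/
def Copy.IsRainbow {V W K : Type*} {G : SimpleGraph V} {H : SimpleGraph W}
    (φ : Copy H G) (c : G.EdgeLabeling K) : Prop :=
  Function.Injective (c.pullback φ.toHom)

/-- The anti-Ramsey property `G →ʳᵇ H` of a finite graph `G`: every proper edge colouring of `G`
(with any number of colours, taken to be natural numbers as `G` is finite) contains a
rainbow copy of `H`. -/
def AntiRamsey {V W : Type*} (G : SimpleGraph V) (H : SimpleGraph W) : Prop :=
  ∀ c : G.EdgeLabeling ℕ, c.IsProper → ∃ φ : Copy H G, φ.IsRainbow c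

end SimpleGraph

/-! A counterexample for which the set of edges is minimal is shown to have too many edges.

In such a graph `G` each edge lies on an `ℓ`-cycle, so all degrees of nonisolated vertices are at
least two. Moreover `G` contains no *reducible* set `F` of edges: the edges outside `F` have a good
colouring by minimality, and if `F` can be coloured such that each `ℓ`-cycle meeting `F` repeats a
colour, then `G` has a good colouring, too (`IsMinimalBad.not_reducible_of_pairs`). Since a cycle
through a vertex of degree two uses both of its edges, the following configurations are reducible:
two adjacent vertices of degree two (`IsMinimalBad.not_adj_two_two`), and a vertex of degree three
with three neighbours of degree two (`IsMinimalBad.not_three_two_two_two`). Counting the edges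
between vertices of degree two and vertices of larger degree then gives average degree at least
`5 / 2` on the nonisolated vertices (`IsMinimalBad.five_mul_card_le`), which contradicts
`m(G) < (ℓ - 1) / (ℓ - 2)` if `ℓ ≥ 6`.

For `ℓ = 5` average degree `8 / 3` is needed. A vertex of degree `d ≥ 3` with `s` neighbours of
degree two has excess `s + 8 - 3 * d`, and the sum of these excesses must be shown to be at most
zero. The excess is positive only for `d = 3` and `s = 2`, where it is one. In that case
the two neighbours of degree two have a second common neighbour `u` of degree at least four
(`IsMinimalBad.exists_of_three_two_two`, `IsTwinApex`), to which the excess is moved. The vertex `u`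
can absorb all that it receives, except if it has degree four and all its neighbours have degree
two; this last configuration is reducible as well (`IsMinimalBad.not_four_two_two_two_two`). -/

namespace SimpleGraph

open Finset

variable {V : Type*}

/-! ### Good colourings, cycles and reducible sets of edges -/

/-- The copies of `C_ℓ` on the vertex set `V`, each given as the graph formed by its edges. -/
def cycleCopies (ℓ : ℕ) (V : Type*) : Set (SimpleGraph V) :=
  {H | ∃ f : Fin ℓ ↪ V, H = (cycleGraph ℓ).map f}

/-- `G` has a proper edge colouring in which each member of `𝒞` contained in `G` repeats a colour.
Colours are assigned to all unordered pairs of vertices; those of non-edges are irrelevant. -/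
def HasGoodColoring (𝒞 : Set (SimpleGraph V)) (G : SimpleGraph V) : Prop :=
  ∃ c : Sym2 V → ℕ, (∀ p x y, G.Adj p x → G.Adj p y → x ≠ y → c s(p, x) ≠ c s(p, y)) ∧
    ∀ H ∈ 𝒞, H ≤ G → ∃ e ∈ H.edgeSet, ∃ f ∈ H.edgeSet, e ≠ f ∧ c e = c f

/-- `G` has no good colouring, but each graph obtained by deleting edges has one. -/
def IsMinimalBad (𝒞 : Set (SimpleGraph V)) (G : SimpleGraph V) : Prop :=
  ¬ HasGoodColoring 𝒞 G ∧ ∀ G' < G, HasGoodColoring 𝒞 G'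

theorem not_antiRamsey_of_hasGoodColoring {ℓ : ℕ} {G : SimpleGraph V}
    (h : HasGoodColoring (cycleCopies ℓ V) G) : ¬ G.AntiRamsey (cycleGraph ℓ) := by
  obtain ⟨c, hc, hcyc⟩ := h
  intro hG
  obtain ⟨φ, hφ⟩ := hG (fun e => c e.1) (by
    rintro ⟨e, he⟩ ⟨f, hf⟩ hef ⟨v, hve, hvf⟩
    simp only at hve hvf
    obtain ⟨x, rfl⟩ := Sym2.mem_iff_exists.1 hve
    obtain ⟨y, rfl⟩ := Sym2.mem_iff_exists.1 hvf
    exact hc v x y he hf (by rintro rfl; exact hef rfl))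
  obtain ⟨e, he, f, hf, hef, hcef⟩ := hcyc ((cycleGraph ℓ).map φ.toEmbedding) ⟨_, rfl⟩ (by
    rw [map_le_iff_le_comap]
    intro x y hxy
    exact φ.toHom.map_adj hxy)
  rw [edgeSet_map] at he hf
  obtain ⟨e, he, rfl⟩ := he
  obtain ⟨f, hf, rfl⟩ := hf
  have := @hφ ⟨e, he⟩ ⟨f, hf⟩ hcef
  exact hef (by rw [Subtype.mk.inj this])

/-- In a copy of a cycle each nonisolated vertex has exactly two neighbours. -/
theorem exists_second_neighbor_of_mem_cycleCopies {ℓ : ℕ} (hℓ : 5 ≤ ℓ) {H : SimpleGraph V}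
    (hH : H ∈ cycleCopies ℓ V) {x y : V} (hxy : H.Adj x y) :
    ∃ z, z ≠ y ∧ H.Adj x z ∧ ∀ t, H.Adj x t → t = y ∨ t = z := by
  obtain ⟨f, rfl⟩ := hH
  obtain ⟨n, rfl⟩ : ∃ n, ℓ = n + 3 := ⟨ℓ - 3, by omega⟩
  have key : ∀ i j : Fin (n + 3), (cycleGraph (n + 3)).Adj i j → ∃ k, k ≠ j ∧
      (cycleGraph (n + 3)).Adj i k ∧ ∀ t, (cycleGraph (n + 3)).Adj i t → t = j ∨ t = k := by
    intro i j hij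
    have h2 : (1 : Fin (n + 3)) + 1 ≠ 0 := by
      rw [Ne, Fin.ext_iff]; simp [Fin.val_add, Nat.mod_eq_of_lt]
    rw [cycleGraph_adj] at hij
    rcases hij with h | h
    · obtain rfl : i = j + 1 := by rw [← h]; abel
      refine ⟨j + 1 + 1, fun h => h2 ?_, by simp [cycleGraph_adj], fun t ht => ?_⟩
      · simpa [add_assoc] using h
      · rw [cycleGraph_adj] at ht
        rcases ht with h | h
        · left; rw [sub_eq_iff_eq_add, add_comm 1 t] at h; exact (add_right_cancel h).symm
        · right; rw [← eq_add_of_sub_eq' h]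
    · obtain rfl : j = i + 1 := by rw [← h]; abel
      refine ⟨i - 1, fun h => h2 ?_, by simp [cycleGraph_adj], fun t ht => ?_⟩
      · rw [sub_eq_iff_eq_add, add_assoc] at h
        simpa using h
      · rw [cycleGraph_adj] at ht
        rcases ht with h | h
        · right; rw [← h]; abel
        · left; rw [← h]; abel
  obtain ⟨-, i, j, hij, rfl, rfl⟩ := hxy
  obtain ⟨k, hk, hik, ht⟩ := key i j hij
  refine ⟨f k, fun h => hk (f.injective h), map_adj_apply.2 hik, ?_⟩
  rintro t ⟨-, i', t, h, h', rfl⟩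
  obtain rfl := f.injective h'
  rcases ht t h with rfl | rfl <;> simp

theorem not_triangle_of_mem_cycleCopies {ℓ : ℕ} (hℓ : 5 ≤ ℓ) {H : SimpleGraph V}
    (hH : H ∈ cycleCopies ℓ V) {x y z : V} (hxy : H.Adj x y) (hyz : H.Adj y z)
    (hzx : H.Adj z x) : False := by
  obtain ⟨f, rfl⟩ := hH
  obtain ⟨-, i, j, hij, rfl, rfl⟩ := hxy
  obtain ⟨-, j', k, hjk, hj, rfl⟩ := hyz
  obtain ⟨-, k', i', hki, hk, hi⟩ := hzx
  obtain rfl := f.injective hj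
  obtain rfl := f.injective hk
  obtain rfl := f.injective hi
  rw [cycleGraph_adj'] at hij hjk hki
  simp only [Fin.val_sub] at hij hjk hki
  have := i'.2; have := j'.2; have := k'.2
  have key : ∀ a b : ℕ, a < ℓ → b < ℓ → (ℓ - a + b) % ℓ = 1 →
      (b = a + 1 ∨ b + ℓ = a + 1) := by
    intro a b ha hb h
    rcases Nat.lt_or_ge (ℓ - a + b) ℓ with h1 | h1
    · rw [Nat.mod_eq_of_lt h1] at h; omega
    · rw [Nat.mod_eq_sub_mod h1, Nat.mod_eq_of_lt (by omega)] at h; omega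
  have := hij.imp (key _ _ (by omega) (by omega)) (key _ _ (by omega) (by omega))
  have := hjk.imp (key _ _ (by omega) (by omega)) (key _ _ (by omega) (by omega))
  have := hki.imp (key _ _ (by omega) (by omega)) (key _ _ (by omega) (by omega))
  omega

theorem not_square_of_mem_cycleCopies_five {H : SimpleGraph V}
    (hH : H ∈ cycleCopies 5 V) {x y z t : V} (hxy : H.Adj x y) (hyz : H.Adj y z)
    (hzt : H.Adj z t) (htx : H.Adj t x) (hxz : x ≠ z) (hyt : y ≠ t) : False := by
  obtain ⟨f, rfl⟩ := hH
  obtain ⟨-, i, j, hij, rfl, rfl⟩ := hxy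
  obtain ⟨-, j', k, hjk, hj, rfl⟩ := hyz
  obtain ⟨-, k', l, hkl, hk, rfl⟩ := hzt
  obtain ⟨-, l', i', hli, hl, hi⟩ := htx
  obtain rfl := f.injective hj
  obtain rfl := f.injective hk
  obtain rfl := f.injective hi
  obtain rfl := f.injective hl
  have key : ∀ i j k l : Fin 5, (cycleGraph 5).Adj i j → (cycleGraph 5).Adj j k →
    (cycleGraph 5).Adj k l → (cycleGraph 5).Adj l i → i = k ∨ j = l := by decide
  rcases key _ _ _ _ hij hjk hkl hli with rfl | rfl <;> simp at hxz hyt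

theorem exists_common_neighbor_of_mem_cycleCopies_five {H : SimpleGraph V}
    (hH : H ∈ cycleCopies 5 V) {x y z t : V} (hxy : H.Adj x y) (hyz : H.Adj y z)
    (hzt : H.Adj z t) (hxz : x ≠ z) (hyt : y ≠ t) : ∃ s, H.Adj x s ∧ H.Adj t s := by
  obtain ⟨f, rfl⟩ := hH
  obtain ⟨-, i, j, hij, rfl, rfl⟩ := hxy
  obtain ⟨-, j', k, hjk, hj, rfl⟩ := hyz
  obtain ⟨-, k', l, hkl, hk, rfl⟩ := hzt
  obtain rfl := f.injective hj
  obtain rfl := f.injective hk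
  have key : ∀ i j k l : Fin 5, (cycleGraph 5).Adj i j → (cycleGraph 5).Adj j k →
    (cycleGraph 5).Adj k l → i ≠ k → j ≠ l →
      ∃ s, (cycleGraph 5).Adj i s ∧ (cycleGraph 5).Adj l s := by decide
  obtain ⟨s, h1, h2⟩ := key i j' k' l hij hjk hkl (by rintro rfl; exact hxz rfl)
    (by rintro rfl; exact hyt rfl)
  exact ⟨f s, map_adj_apply.2 h1, map_adj_apply.2 h2⟩

/-- In a minimal bad graph there is no set `F` of edges to which a colouring of the rest extends.
The extension is encoded by `r`: an edge `e ∈ F` receives the colour of `r e`, where elements of `F`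
stand for pairwise different new colours and edges outside `F` for their old colours. -/
theorem IsMinimalBad.not_reducible [Finite V] {𝒞 : Set (SimpleGraph V)} {G : SimpleGraph V}
    (hG : IsMinimalBad 𝒞 G) (F : Set (Sym2 V)) (hF : ∃ e ∈ F, e ∈ G.edgeSet)
    (r : Sym2 V → Sym2 V) (hr : ∀ e ∉ F, r e = e)
    (hproper : ∀ p x y, G.Adj p x → G.Adj p y → x ≠ y → s(p, x) ∈ F →
      r s(p, x) ≠ r s(p, y) ∧ (r s(p, x) ∈ F ∨ r s(p, y) ∈ F))
    (hcyc : ∀ H ∈ 𝒞, H ≤ G → (∃ e ∈ F, e ∈ H.edgeSet) →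
      ∃ e ∈ H.edgeSet, ∃ f ∈ H.edgeSet, e ≠ f ∧ r e = r f) : False := by
  classical
  obtain ⟨c, hc, hc'⟩ := hG.2 (G.deleteEdges F) (by
    refine lt_of_le_of_ne (deleteEdges_le F) fun h => ?_
    obtain ⟨e, heF, he⟩ := hF
    rw [← h, edgeSet_deleteEdges] at he
    exact he.2 heF)
  obtain ⟨N, hN⟩ := (Set.finite_range c).bddAbove
  obtain ⟨enc, henc⟩ := exists_injective_nat (Sym2 V)
  let d : Sym2 V → ℕ := fun e => if e ∈ F then N + 1 + enc e else c e
  have hd : ∀ e f, e ≠ f → (e ∈ F ∨ f ∈ F) → d e ≠ d f := by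
    intro e f hef h
    have h1 : c e ≤ N := hN ⟨e, rfl⟩
    have h2 : c f ≤ N := hN ⟨f, rfl⟩
    have h3 : enc e ≠ enc f := fun h => hef (henc h)
    simp only [d]
    split_ifs <;> first | omega | tauto
  refine hG.1 ⟨fun e => d (r e), fun p x y hpx hpy hxy => ?_, fun H hH hHG => ?_⟩
  · by_cases hx : s(p, x) ∈ F
    · obtain ⟨h1, h2⟩ := hproper p x y hpx hpy hxy hx
      exact hd _ _ h1 h2
    by_cases hy : s(p, y) ∈ F
    · obtain ⟨h1, h2⟩ := hproper p y x hpy hpx hxy.symm hy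
      exact (hd _ _ h1 h2).symm
    simp only [hr _ hx, hr _ hy, d, hx, hy, if_false]
    exact hc p x y (by simp [hpx, hx]) (by simp [hpy, hy]) hxy
  · by_cases h : ∃ e ∈ F, e ∈ H.edgeSet
    · obtain ⟨e, he, f, hf, hef, h⟩ := hcyc H hH hHG h
      exact ⟨e, he, f, hf, hef, by simp only [h]⟩
    push Not at h
    obtain ⟨e, he, f, hf, hef, hcef⟩ := hc' H hH (fun x y hxy => by
      simp only [deleteEdges_adj]
      exact ⟨hHG hxy, fun hF => h _ hF hxy⟩)
    refine ⟨e, he, f, hf, hef, ?_⟩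
    have hn : ∀ e ∈ H.edgeSet, e ∉ F := fun e he hF => h e hF he
    simp only [hr _ (hn e he), hr _ (hn f hf), d, hn e he, hn f hf, if_false, hcef]

/-- A convenient form of `IsMinimalBad.not_reducible`: an element `(e, g)` of `M` requests that
the edge `e ∈ F` gets the same colour as `g`, and all other edges of `F` get new colours. By
`hold`, if `e` gets an old colour, then all other edges of `G` at the ends of `e` lie in `F` and
get new colours. -/
theorem IsMinimalBad.not_reducible_of_pairs [Finite V] {𝒞 : Set (SimpleGraph V)}
    {G : SimpleGraph V} (hG : IsMinimalBad 𝒞 G) (F : Set (Sym2 V)) (hF : ∃ e ∈ F, e ∈ G.edgeSet)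
    (M : Set (Sym2 V × Sym2 V)) (hMF : ∀ p ∈ M, p.1 ∈ F)
    (hfun : ∀ p ∈ M, ∀ q ∈ M, p.1 = q.1 → p = q)
    (htarget : ∀ p ∈ M, ∀ q ∈ M, p.2 ≠ q.1)
    (hdisj : ∀ p ∈ M, ∀ v ∈ p.1, v ∉ p.2)
    (hdisj' : ∀ p ∈ M, ∀ q ∈ M, p ≠ q → p.2 = q.2 → ∀ v ∈ p.1, v ∉ q.1)
    (hold : ∀ p ∈ M, p.2 ∉ F → ∀ e ∈ G.edgeSet, e ≠ p.1 → ∀ v ∈ p.1, v ∈ e →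
      e ∈ F ∧ ∀ q ∈ M, q.1 = e → q.2 ∈ F)
    (hcyc : ∀ H ∈ 𝒞, H ≤ G → (∃ e ∈ F, e ∈ H.edgeSet) →
      (∃ p ∈ M, p.1 ∈ H.edgeSet ∧ p.2 ∈ H.edgeSet) ∨
      ∃ p ∈ M, ∃ q ∈ M, p ≠ q ∧ p.2 = q.2 ∧ p.1 ∈ H.edgeSet ∧ q.1 ∈ H.edgeSet) : False := by
  classical
  let r : Sym2 V → Sym2 V := fun e => if h : ∃ g, (e, g) ∈ M then h.choose else e
  have hr1 : ∀ p ∈ M, r p.1 = p.2 := by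
    intro p hp
    have h : ∃ g, (p.1, g) ∈ M := ⟨p.2, hp⟩
    simp only [r, h, dif_pos]
    exact congrArg Prod.snd (hfun _ h.choose_spec _ hp rfl)
  have hr2 : ∀ e, (∀ g, (e, g) ∉ M) → r e = e := by
    intro e he
    simp [r, he]
  have hr : ∀ e, r e = e ∨ (e, r e) ∈ M := by
    intro e
    by_cases h : ∃ g, (e, g) ∈ M
    · obtain ⟨g, hg⟩ := h
      right
      rw [hr1 _ hg]
      exact hg
    · left
      push Not at h
      exact hr2 e h
  have hrF : ∀ e ∈ F, ∀ f ∈ G.edgeSet, e ≠ f → (∃ v ∈ e, v ∈ f) → r e ∈ F ∨ r f ∈ F := by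
    rintro e he f hf hef ⟨v, hve, hvf⟩
    by_contra! hno
    rcases hr e with h | h
    · exact hno.1 (by rwa [h])
    obtain ⟨hfF, h'⟩ := hold _ h hno.1 f hf hef.symm v hve hvf
    rcases hr f with h1 | h1
    · exact hno.2 (by rwa [h1])
    · exact hno.2 (h' _ h1 rfl)
  refine hG.not_reducible F hF r (fun e he => hr2 e fun g hg => he (hMF _ hg)) ?_ ?_
  · intro v x y hvx hvy hxy hxF
    have hne : s(v, x) ≠ s(v, y) := by rwa [Ne, Sym2.congr_right]
    refine ⟨fun h => ?_, hrF _ hxF _ hvy hne ⟨v, by simp, by simp⟩⟩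
    rcases hr s(v, x) with hx | hx <;> rcases hr s(v, y) with hy | hy
    · exact hne (hx.symm.trans (h.trans hy))
    · exact hdisj _ hy v (by simp) (by simp only [← h, hx]; simp)
    · exact hdisj _ hx v (by simp) (by simp only [h, hy]; simp)
    · exact hdisj' _ hx _ hy (fun h => hne (congrArg Prod.fst h)) h v (by simp) (by simp)
  · intro H hH hHG hHF
    rcases hcyc H hH hHG hHF with ⟨p, hp, h1, h2⟩ | ⟨p, hp, q, hq, hpq, h, h1, h2⟩
    · refine ⟨_, h1, _, h2, (htarget _ hp _ hp).symm, ?_⟩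
      rw [hr1 _ hp, hr2 _ fun g hg => htarget _ hp _ hg rfl]
    · refine ⟨_, h1, _, h2, fun h => hpq (hfun _ hp _ hq h), ?_⟩
      rw [hr1 _ hp, hr1 _ hq, h]

theorem IsMinimalBad.exists_cycle [Finite V] {𝒞 : Set (SimpleGraph V)} {G : SimpleGraph V}
    (hG : IsMinimalBad 𝒞 G) {x y : V} (hxy : G.Adj x y) : ∃ H ∈ 𝒞, H ≤ G ∧ H.Adj x y := by
  by_contra! hno
  refine hG.not_reducible_of_pairs {s(x, y)} ⟨_, rfl, hxy⟩ ∅ (by simp) (by simp) (by simp)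
    (by simp) (by simp) (by simp) ?_
  rintro H hH hHG ⟨e, rfl, he⟩
  exact absurd he (hno H hH hHG)

/-! ### Reducible configurations for all cycle lengths -/

section Reductions

variable {ℓ : ℕ} {G H : SimpleGraph V}

theorem adj_iff_of_mem_cycleCopies_of_two (hℓ : 5 ≤ ℓ) (hH : H ∈ cycleCopies ℓ V) (hHG : H ≤ G)
    {q p r : V} (hq : ∀ x, G.Adj q x ↔ x = p ∨ x = r) : H.Adj q p ↔ H.Adj q r := by
  constructor
  all_goals
    intro h
    obtain ⟨z, hz, hqz, -⟩ := exists_second_neighbor_of_mem_cycleCopies hℓ hH h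
    rcases (hq z).1 (hHG hqz) with rfl | rfl
    · first | exact absurd rfl hz | exact hqz
    · first | exact absurd rfl hz | exact hqz

theorem adj_and_adj_of_mem_cycleCopies_of_three (hℓ : 5 ≤ ℓ) (hH : H ∈ cycleCopies ℓ V)
    (hHG : H ≤ G) {v a b c : V} (hv : ∀ x, G.Adj v x ↔ x = a ∨ x = b ∨ x = c)
    (h : H.Adj v a ∨ H.Adj v b ∨ H.Adj v c) :
    H.Adj v a ∧ H.Adj v b ∨ H.Adj v b ∧ H.Adj v c ∨ H.Adj v c ∧ H.Adj v a := by
  rcases h with h | h | h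
  all_goals
    obtain ⟨z, hz, hvz, -⟩ := exists_second_neighbor_of_mem_cycleCopies hℓ hH h
    rcases (hv z).1 (hHG hvz) with rfl | rfl | rfl <;> simp_all

/-- A path `p q r s` whose inner vertices have degree two is reducible: the edges `pq` and `rs`
get the same colour. -/
theorem IsMinimalBad.not_adj_two_two [Finite V] (hℓ : 5 ≤ ℓ)
    (hG : IsMinimalBad (cycleCopies ℓ V) G) {p q r s : V} (hpr : p ≠ r) (hqs : q ≠ s)
    (hq : ∀ x, G.Adj q x ↔ x = p ∨ x = r) (hr : ∀ x, G.Adj r x ↔ x = q ∨ x = s) : False := by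
  classical
  have hqr : G.Adj q r := (hq r).2 (.inr rfl)
  have hqp : G.Adj q p := (hq p).2 (.inl rfl)
  have hrs : G.Adj r s := (hr s).2 (.inr rfl)
  have n1 := hqr.ne
  have n2 := hqp.ne
  have n3 := hrs.ne
  have key : ∀ H ∈ cycleCopies ℓ V, H ≤ G → (H.Adj q p ∨ H.Adj q r ∨ H.Adj r s) →
      H.Adj q p ∧ H.Adj q r ∧ H.Adj r s := by
    intro H hH hHG h
    have h1 := adj_iff_of_mem_cycleCopies_of_two hℓ hH hHG hq
    have h2 := adj_iff_of_mem_cycleCopies_of_two hℓ hH hHG hr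
    have := H.adj_comm q r
    tauto
  by_cases hps : p = s
  · subst hps
    obtain ⟨H, hH, hHG, h⟩ := hG.exists_cycle hqr
    obtain ⟨h1, h2, h3⟩ := key H hH hHG (.inr (.inl h))
    exact not_triangle_of_mem_cycleCopies hℓ hH h2 h3 h1.symm
  refine hG.not_reducible_of_pairs {s(q, p), s(q, r), s(r, s)} ⟨s(q, p), by simp, hqp⟩
    {(s(q, p), s(r, s))} ?_ ?_ ?_ ?_ ?_ ?_ ?_
  · simp
  · simp
  · simp; grind
  · simp; grind
  · simp
  · simp
  · intro H hH hHG hF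
    left
    simp only [Set.mem_insert_iff, Set.mem_singleton_iff, exists_eq_or_imp, exists_eq_left,
      mem_edgeSet] at hF ⊢
    obtain ⟨h1, h2, h3⟩ := key H hH hHG hF
    exact ⟨h1, h3⟩

/-- The vertex `q` has exactly two neighbours. -/
def HasTwoNeighbors (G : SimpleGraph V) (q : V) : Prop :=
  ∃ p r, p ≠ r ∧ ∀ x, G.Adj q x ↔ x = p ∨ x = r

theorem HasTwoNeighbors.exists_other {q p : V} (hq : G.HasTwoNeighbors q) (h : G.Adj q p) :
    ∃ r, p ≠ r ∧ ∀ x, G.Adj q x ↔ x = p ∨ x = r := by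
  obtain ⟨p', r, hpr, hq⟩ := hq
  rcases (hq p).1 h with rfl | rfl
  · exact ⟨r, hpr, hq⟩
  · exact ⟨p', hpr.symm, fun x => (hq x).trans or_comm⟩

theorem IsMinimalBad.not_adj_of_hasTwoNeighbors [Finite V] (hℓ : 5 ≤ ℓ)
    (hG : IsMinimalBad (cycleCopies ℓ V) G) {q r : V} (hq : G.HasTwoNeighbors q)
    (hr : G.HasTwoNeighbors r) : ¬ G.Adj q r := by
  intro h
  obtain ⟨p, hpr, hq⟩ := hq.exists_other h
  obtain ⟨s, hqs, hr⟩ := hr.exists_other h.symm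
  exact hG.not_adj_two_two hℓ hpr.symm hqs (fun x => (hq x).trans or_comm) hr

/-- A vertex `v` of degree three whose neighbours `a`, `b`, `c` have degree two is reducible: if
`a'`, `b'`, `c'` are their other neighbours, then `aa'`, `bb'`, `cc'` get the colours of
`vb`, `vc`, `va`. -/
theorem IsMinimalBad.not_three_two_two_two [Finite V] (hℓ : 5 ≤ ℓ)
    (hG : IsMinimalBad (cycleCopies ℓ V) G) {v a b c a' b' c' : V}
    (hab : a ≠ b) (hac : a ≠ c) (hbc : b ≠ c) (hva' : v ≠ a') (hvb' : v ≠ b') (hvc' : v ≠ c')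
    (hv : ∀ x, G.Adj v x ↔ x = a ∨ x = b ∨ x = c)
    (ha : ∀ x, G.Adj a x ↔ x = v ∨ x = a') (hb : ∀ x, G.Adj b x ↔ x = v ∨ x = b')
    (hc : ∀ x, G.Adj c x ↔ x = v ∨ x = c') : False := by
  classical
  have hva : G.Adj v a := (hv a).2 (by simp)
  have hvb : G.Adj v b := (hv b).2 (by simp)
  have hvc : G.Adj v c := (hv c).2 (by simp)
  have haa : G.Adj a a' := (ha a').2 (by simp)
  have hbb : G.Adj b b' := (hb b').2 (by simp)
  have hcc : G.Adj c c' := (hc c').2 (by simp)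
  have nab := hG.not_adj_of_hasTwoNeighbors hℓ ⟨v, a', hva', ha⟩ ⟨v, b', hvb', hb⟩
  have nac := hG.not_adj_of_hasTwoNeighbors hℓ ⟨v, a', hva', ha⟩ ⟨v, c', hvc', hc⟩
  have nbc := hG.not_adj_of_hasTwoNeighbors hℓ ⟨v, b', hvb', hb⟩ ⟨v, c', hvc', hc⟩
  have m1 := hva.ne
  have m2 := hvb.ne
  have m3 := hvc.ne
  have m4 := haa.ne
  have m5 := hbb.ne
  have m6 := hcc.ne
  have k1 : a' ≠ b := by rintro rfl; exact nab haa
  have k2 : a' ≠ c := by rintro rfl; exact nac haa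
  have k3 : b' ≠ a := by rintro rfl; exact nab hbb.symm
  have k4 : b' ≠ c := by rintro rfl; exact nbc hbb
  have k5 : c' ≠ a := by rintro rfl; exact nac hcc.symm
  have k6 : c' ≠ b := by rintro rfl; exact nbc hcc.symm
  refine hG.not_reducible_of_pairs {s(v, a), s(v, b), s(v, c), s(a, a'), s(b, b'), s(c, c')}
    ⟨s(v, a), by simp, hva⟩
    {(s(a, a'), s(v, b)), (s(b, b'), s(v, c)), (s(c, c'), s(v, a))} ?_ ?_ ?_ ?_ ?_ ?_ ?_
  · simp
  · simp; grind
  · simp; grind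
  · simp; grind
  · simp; grind
  · simp
  · intro H hH hHG hF
    left
    simp only [Set.mem_insert_iff, Set.mem_singleton_iff, exists_eq_or_imp, exists_eq_left,
      mem_edgeSet] at hF ⊢
    have a1 := adj_iff_of_mem_cycleCopies_of_two hℓ hH hHG ha
    have b1 := adj_iff_of_mem_cycleCopies_of_two hℓ hH hHG hb
    have c1 := adj_iff_of_mem_cycleCopies_of_two hℓ hH hHG hc
    have s1 := H.adj_comm a v
    have s2 := H.adj_comm b v
    have s3 := H.adj_comm c v
    rw [← a1, ← b1, ← c1, s1, s2, s3] at hF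
    have h0 : H.Adj v a ∨ H.Adj v b ∨ H.Adj v c := by grind
    rw [← a1, ← b1, ← c1, s1, s2, s3]
    have := adj_and_adj_of_mem_cycleCopies_of_three hℓ hH hHG hv h0
    grind

end Reductions

/-! ### Configurations for 5-cycles -/

section FiveCycles

variable {ℓ : ℕ} {G : SimpleGraph V}

/-- A vertex `v` with neighbours `a`, `b`, `w`, where `a`, `b` have degree two and other neighbours
`a'`, `b'`, is reducible if `a'`, `b'`, `w` are distinct: `aa'`, `bb'`, `vw` get the same colour. -/
theorem IsMinimalBad.not_three_two_two_of_ne [Finite V] (hℓ : 5 ≤ ℓ)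
    (hG : IsMinimalBad (cycleCopies ℓ V) G) {v a b w a' b' : V}
    (hab : a ≠ b) (haw : a ≠ w) (hbw : b ≠ w) (hva' : v ≠ a') (hvb' : v ≠ b')
    (hv : ∀ x, G.Adj v x ↔ x = a ∨ x = b ∨ x = w)
    (ha : ∀ x, G.Adj a x ↔ x = v ∨ x = a') (hb : ∀ x, G.Adj b x ↔ x = v ∨ x = b')
    (h1 : a' ≠ b') (h2 : a' ≠ w) (h3 : b' ≠ w) : False := by
  have nab := hG.not_adj_of_hasTwoNeighbors hℓ ⟨v, a', hva', ha⟩ ⟨v, b', hvb', hb⟩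
  have m1 : v ≠ a := ((hv a).2 (by simp)).ne
  have m2 : v ≠ b := ((hv b).2 (by simp)).ne
  have m3 : v ≠ w := ((hv w).2 (by simp)).ne
  have m4 : a ≠ a' := ((ha a').2 (by simp)).ne
  have m5 : b ≠ b' := ((hb b').2 (by simp)).ne
  have k1 : a' ≠ b := by rintro rfl; exact nab ((ha _).2 (by simp))
  have k2 : b' ≠ a := by rintro rfl; exact nab ((hb _).2 (by simp)).symm
  refine hG.not_reducible_of_pairs {s(v, a), s(v, b), s(v, w), s(a, a'), s(b, b')}
    ⟨s(v, a), by simp, (hv a).2 (by simp)⟩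
    {(s(a, a'), s(v, w)), (s(b, b'), s(v, w))} ?_ ?_ ?_ ?_ ?_ ?_ ?_
  · simp
  · simp
  · simp; grind
  · simp; grind
  · simp; grind
  · simp
  · intro H hH hHG hF
    simp only [Set.mem_insert_iff, Set.mem_singleton_iff, exists_eq_or_imp, exists_eq_left,
      mem_edgeSet] at hF
    have a1 := adj_iff_of_mem_cycleCopies_of_two hℓ hH hHG ha
    have b1 := adj_iff_of_mem_cycleCopies_of_two hℓ hH hHG hb
    have v1 := adj_and_adj_of_mem_cycleCopies_of_three hℓ hH hHG hv
    have s1 := H.adj_comm a v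
    have s2 := H.adj_comm b v
    by_cases h : H.Adj v w
    · left
      simp only [Set.mem_insert_iff, Set.mem_singleton_iff, exists_eq_or_imp, exists_eq_left,
        mem_edgeSet]
      grind
    -- the cycle passes through `a` and `b`, whose outer edges have the same colour
    · right
      refine ⟨_, .inl rfl, _, .inr rfl, ?_, rfl, ?_, ?_⟩
      · simp; grind
      · rw [mem_edgeSet]; grind
      · rw [mem_edgeSet]; grind

/-- A vertex `v` with neighbours `a`, `b`, `w`, where `a` has neighbours `v`, `w` and `b` has
neighbours `v`, `b'`, is reducible: `aw` gets the colour of `vb`, and `bb'` that of `vw`. -/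
theorem IsMinimalBad.not_three_two_two_of_adj [Finite V] (hℓ : 5 ≤ ℓ)
    (hG : IsMinimalBad (cycleCopies ℓ V) G) {v a b w b' : V}
    (hab : a ≠ b) (haw : a ≠ w) (hbw : b ≠ w) (hvb' : v ≠ b')
    (hv : ∀ x, G.Adj v x ↔ x = a ∨ x = b ∨ x = w)
    (ha : ∀ x, G.Adj a x ↔ x = v ∨ x = w) (hb : ∀ x, G.Adj b x ↔ x = v ∨ x = b')
    (h : b' ≠ w) : False := by
  have hvw : G.Adj v w := (hv w).2 (by simp)
  have nab := hG.not_adj_of_hasTwoNeighbors hℓ ⟨v, w, hvw.ne, ha⟩ ⟨v, b', hvb', hb⟩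
  have m1 : v ≠ a := ((hv a).2 (by simp)).ne
  have m2 : v ≠ b := ((hv b).2 (by simp)).ne
  have m3 : v ≠ w := hvw.ne
  have m5 : b ≠ b' := ((hb b').2 (by simp)).ne
  have k2 : b' ≠ a := by rintro rfl; exact nab ((hb _).2 (by simp)).symm
  refine hG.not_reducible_of_pairs {s(v, a), s(v, b), s(v, w), s(a, w), s(b, b')}
    ⟨s(v, a), by simp, (hv a).2 (by simp)⟩
    {(s(a, w), s(v, b)), (s(b, b'), s(v, w))} ?_ ?_ ?_ ?_ ?_ ?_ ?_
  · simp
  · simp; grind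
  · simp; grind
  · simp; grind
  · simp; grind
  · simp
  · intro H hH hHG hF
    left
    simp only [Set.mem_insert_iff, Set.mem_singleton_iff, exists_eq_or_imp, exists_eq_left,
      mem_edgeSet] at hF ⊢
    have a1 := adj_iff_of_mem_cycleCopies_of_two hℓ hH hHG ha
    have b1 := adj_iff_of_mem_cycleCopies_of_two hℓ hH hHG hb
    have v1 := adj_and_adj_of_mem_cycleCopies_of_three hℓ hH hHG hv
    have s1 := H.adj_comm a v
    have s2 := H.adj_comm b v
    have t : ¬ (H.Adj v w ∧ H.Adj v a) := fun ⟨h1, h2⟩ =>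
      not_triangle_of_mem_cycleCopies hℓ hH h1 ((a1.1 h2.symm).symm) h2.symm
    grind

/-- A vertex `v` of degree three with two neighbours `a`, `b` of degree two, for 5-cycles: the
other neighbours of `a` and `b` coincide, and this vertex `u` has two common neighbours with the
third neighbour `w` of `v`. Indeed, if `x` is the only common neighbour of `u` and `w`, then `au`
can be given the colour of `vw`, and `bv` the old colour of `wx`. -/
theorem IsMinimalBad.exists_of_three_two_two [Finite V]
    (hG : IsMinimalBad (cycleCopies 5 V) G) {v a b w a' b' : V}
    (hab : a ≠ b) (haw : a ≠ w) (hbw : b ≠ w) (hva' : v ≠ a') (hvb' : v ≠ b')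
    (hv : ∀ x, G.Adj v x ↔ x = a ∨ x = b ∨ x = w)
    (ha : ∀ x, G.Adj a x ↔ x = v ∨ x = a') (hb : ∀ x, G.Adj b x ↔ x = v ∨ x = b') :
    a' = b' ∧ a' ≠ w ∧ ∃ x y, x ≠ y ∧ G.Adj a' x ∧ G.Adj w x ∧ G.Adj a' y ∧ G.Adj w y := by
  have hℓ : 5 ≤ 5 := le_rfl
  have hva : G.Adj v a := (hv a).2 (by simp)
  have hvb : G.Adj v b := (hv b).2 (by simp)
  have hvw : G.Adj v w := (hv w).2 (by simp)
  have m1 := hva.ne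
  have m2 := hvb.ne
  have m3 := hvw.ne
  have hv' : ∀ x, G.Adj v x ↔ x = b ∨ x = a ∨ x = w := fun x => by rw [hv]; grind
  have hu : a' = b' := by
    by_contra hu
    by_cases h2 : a' = w
    · subst h2
      exact hG.not_three_two_two_of_adj hℓ hab haw hbw hvb' hv ha hb (Ne.symm hu)
    by_cases h3 : b' = w
    · subst h3
      exact hG.not_three_two_two_of_adj hℓ hab.symm hbw haw hva' hv' hb ha h2
    exact hG.not_three_two_two_of_ne hℓ hab haw hbw hva' hvb' hv ha hb hu h2 h3
  subst hu
  have m4 : a ≠ a' := ((ha a').2 (by simp)).ne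
  have m5 : b ≠ a' := ((hb a').2 (by simp)).ne
  -- the cycles through `a` or `b` use the edge `vw`, since there is no 4-cycle in a 5-cycle
  have key : ∀ H ∈ cycleCopies 5 V, H ≤ G →
      (H.Adj v a ∨ H.Adj v b ∨ H.Adj v w ∨ H.Adj a a' ∨ H.Adj b a') →
      H.Adj v w ∧ (H.Adj v a ∧ H.Adj a a' ∨ H.Adj v b ∧ H.Adj b a') := by
    intro H hH hHG hF
    have a1 := adj_iff_of_mem_cycleCopies_of_two hℓ hH hHG ha
    have b1 := adj_iff_of_mem_cycleCopies_of_two hℓ hH hHG hb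
    have v1 := adj_and_adj_of_mem_cycleCopies_of_three hℓ hH hHG hv
    have s1 := H.adj_comm a v
    have s2 := H.adj_comm b v
    have t : ¬ (H.Adj v a ∧ H.Adj v b) := fun ⟨h1, h2⟩ =>
      not_square_of_mem_cycleCopies_five hH h1 (a1.1 h1.symm) (b1.1 h2.symm).symm h2.symm hva' hab
    grind
  have huw : a' ≠ w := by
    rintro rfl
    obtain ⟨H, hH, hHG, h⟩ := hG.exists_cycle hva
    obtain ⟨h1, ⟨h2, h3⟩ | ⟨h2, h3⟩⟩ := key H hH hHG (.inl h)
    · exact not_triangle_of_mem_cycleCopies hℓ hH h2 h3 h1.symm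
    · exact not_triangle_of_mem_cycleCopies hℓ hH h2 h3 h1.symm
  refine ⟨rfl, huw, ?_⟩
  have close : ∀ H ∈ cycleCopies 5 V, H ≤ G → H.Adj v w →
      (H.Adj v a ∧ H.Adj a a' ∨ H.Adj v b ∧ H.Adj b a') → ∃ x, H.Adj a' x ∧ H.Adj w x := by
    rintro H hH hHG h1 (⟨h2, h3⟩ | ⟨h2, h3⟩)
    · exact exists_common_neighbor_of_mem_cycleCopies_five hH h3.symm h2.symm h1 hva'.symm haw
    · exact exists_common_neighbor_of_mem_cycleCopies_five hH h3.symm h2.symm h1 hva'.symm hbw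
  obtain ⟨x, hux, hwx⟩ : ∃ x, G.Adj a' x ∧ G.Adj w x := by
    obtain ⟨H, hH, hHG, h⟩ := hG.exists_cycle hva
    obtain ⟨h1, h2⟩ := key H hH hHG (.inl h)
    obtain ⟨x, hx, hx'⟩ := close H hH hHG h1 h2
    exact ⟨x, hHG hx, hHG hx'⟩
  by_contra! hno
  have hx : ∀ y, G.Adj a' y → G.Adj w y → y = x := fun y h1 h2 => by
    by_contra hxy
    exact hno x y (Ne.symm hxy) hux hwx h1 h2
  have n1 := hux.ne
  have n2 := hwx.ne
  have n3 : x ≠ v := by rintro rfl; have := (hv _).1 hux.symm; grind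
  have n4 : x ≠ a := by rintro rfl; have := (ha _).1 hwx.symm; grind
  have n5 : x ≠ b := by rintro rfl; have := (hb _).1 hwx.symm; grind
  refine hG.not_reducible_of_pairs {s(v, a), s(v, b), s(v, w), s(a, a'), s(b, a')}
    ⟨s(v, a), by simp, hva⟩
    {(s(a, a'), s(v, w)), (s(v, b), s(w, x))} ?_ ?_ ?_ ?_ ?_ ?_ ?_
  · simp
  · simp; grind
  · simp; grind
  · simp; grind
  · simp; grind
  -- only `vb` gets an old colour, and the edges at `v` and `b` are all recoloured
  · rintro ⟨p1, p2⟩ hp hpF e he hne y hy hye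
    have hpe : p1 = s(v, b) := by
      simp at hp
      rcases hp with ⟨rfl, rfl⟩ | ⟨rfl, rfl⟩
      · simp at hpF
      · rfl
    subst hpe
    obtain ⟨z, rfl⟩ := Sym2.mem_iff_exists.1 hye
    rw [mem_edgeSet] at he
    simp only [Sym2.mem_iff] at hy
    rcases hy with rfl | rfl
    · rcases (hv z).1 he with rfl | rfl | rfl
      all_goals simp at hne ⊢
      all_goals grind
    · rcases (hb z).1 he with rfl | rfl
      all_goals simp at hne ⊢
      all_goals grind
  · intro H hH hHG hF
    left
    simp only [Set.mem_insert_iff, Set.mem_singleton_iff, exists_eq_or_imp, exists_eq_left,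
      mem_edgeSet] at hF ⊢
    obtain ⟨h1, h2⟩ := key H hH hHG hF
    obtain ⟨y, h3, h4⟩ := close H hH hHG h1 h2
    obtain rfl := hx y (hHG h3) (hHG h4)
    grind

/-- A vertex `u` of degree four whose neighbours have degree two, two of them being adjacent to a
vertex `v` of degree three and the other two to the third neighbour `w` of `v`, is reducible: `ua`,
`vb`, `ub` get the colours of `vw`, `wx`, `wy`. -/
theorem IsMinimalBad.not_four_two_two_two_two [Finite V]
    (hG : IsMinimalBad (cycleCopies 5 V) G) {u v w a b x y : V} (hab : a ≠ b) (hax : a ≠ x)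
    (hay : a ≠ y) (hbx : b ≠ x) (hby : b ≠ y) (hxy : x ≠ y) (huv : u ≠ v) (huw : u ≠ w)
    (hu : ∀ t, G.Adj u t ↔ t = a ∨ t = b ∨ t = x ∨ t = y)
    (hv : ∀ t, G.Adj v t ↔ t = a ∨ t = b ∨ t = w)
    (ha : ∀ t, G.Adj a t ↔ t = v ∨ t = u) (hb : ∀ t, G.Adj b t ↔ t = v ∨ t = u)
    (hx : ∀ t, G.Adj x t ↔ t = w ∨ t = u) (hy : ∀ t, G.Adj y t ↔ t = w ∨ t = u) : False := by
  have hℓ : 5 ≤ 5 := le_rfl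
  have hua : G.Adj u a := (hu a).2 (by simp)
  have hub : G.Adj u b := (hu b).2 (by simp)
  have hux : G.Adj u x := (hu x).2 (by simp)
  have huy : G.Adj u y := (hu y).2 (by simp)
  have hvw : G.Adj v w := (hv w).2 (by simp)
  have hva : G.Adj v a := (hv a).2 (by simp)
  have hvb : G.Adj v b := (hv b).2 (by simp)
  have hxw : G.Adj x w := (hx w).2 (by simp)
  have hyw : G.Adj y w := (hy w).2 (by simp)
  have n1 := hua.ne
  have n2 := hub.ne
  have n3 := hux.ne
  have n4 := huy.ne
  have n5 := hvw.ne
  have n6 := hva.ne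
  have n7 := hvb.ne
  have n8 := hxw.ne
  have n9 := hyw.ne
  have k1 : a ≠ w := by rintro rfl; have := (ha _).1 hxw.symm; grind
  have k2 : b ≠ w := by rintro rfl; have := (hb _).1 hxw.symm; grind
  have k3 : x ≠ v := by rintro rfl; have := (hx _).1 hva; grind
  have k4 : y ≠ v := by rintro rfl; have := (hy _).1 hva; grind
  refine hG.not_reducible_of_pairs {s(u, a), s(u, b), s(u, x), s(u, y), s(v, a), s(v, b), s(v, w),
      s(x, w), s(y, w)} ⟨s(u, a), by simp, hua⟩
    {(s(u, a), s(v, w)), (s(v, b), s(x, w)), (s(u, b), s(y, w))} ?_ ?_ ?_ ?_ ?_ ?_ ?_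
  · simp
  · simp; grind
  · simp; grind
  · simp; grind
  · simp; grind
  · simp
  · intro H hH hHG hF
    left
    simp only [Set.mem_insert_iff, Set.mem_singleton_iff, exists_eq_or_imp, exists_eq_left,
      mem_edgeSet] at hF ⊢
    have a1 := adj_iff_of_mem_cycleCopies_of_two hℓ hH hHG ha
    have b1 := adj_iff_of_mem_cycleCopies_of_two hℓ hH hHG hb
    have x1 := adj_iff_of_mem_cycleCopies_of_two hℓ hH hHG hx
    have y1 := adj_iff_of_mem_cycleCopies_of_two hℓ hH hHG hy
    have v1 := adj_and_adj_of_mem_cycleCopies_of_three hℓ hH hHG hv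
    have s1 := H.adj_comm a v
    have s2 := H.adj_comm b v
    have s3 := H.adj_comm a u
    have s4 := H.adj_comm b u
    have s5 := H.adj_comm x u
    have s6 := H.adj_comm y u
    have s7 := H.adj_comm x w
    have s8 := H.adj_comm y w
    -- so `H` passes `u` from `a` or `b` to `x` or `y`, and then uses `vw`
    have c1 : ¬ (H.Adj u a ∧ H.Adj u b) := fun ⟨h1, h2⟩ => not_square_of_mem_cycleCopies_five hH h1
      (a1.2 h1.symm) (b1.2 h2.symm).symm h2.symm huv hab
    have c2 : ¬ (H.Adj u x ∧ H.Adj u y) := fun ⟨h1, h2⟩ => not_square_of_mem_cycleCopies_five hH h1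
      (x1.2 h1.symm) (y1.2 h2.symm).symm h2.symm huw hxy
    have u1 : H.Adj u a ∨ H.Adj u b ∨ H.Adj u x ∨ H.Adj u y := by grind
    have u2 : ∃ p q, p ≠ q ∧ H.Adj u p ∧ H.Adj u q := by
      rcases u1 with h | h | h | h <;>
      · obtain ⟨z, hz, h', -⟩ := exists_second_neighbor_of_mem_cycleCopies hℓ hH h
        exact ⟨_, z, hz.symm, h, h'⟩
    obtain ⟨p, q, hpq, hp, hq⟩ := u2
    have hp' := (hu p).1 (hHG hp)
    have hq' := (hu q).1 (hHG hq)
    grind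

end FiveCycles

/-! ### Discharging -/

section Discharging

variable [Fintype V] {ℓ : ℕ} (G : SimpleGraph V) [DecidableRel G.Adj]

/-- The neighbours of `v` that have degree two. -/
def degreeTwoNeighbors (v : V) : Finset V := {a ∈ G.neighborFinset v | G.degree a = 2}

variable {G}

theorem mem_degreeTwoNeighbors {v a : V} :
    a ∈ G.degreeTwoNeighbors v ↔ G.Adj v a ∧ G.degree a = 2 := by
  simp [degreeTwoNeighbors]

theorem card_degreeTwoNeighbors_le (v : V) : (G.degreeTwoNeighbors v).card ≤ G.degree v :=
  Finset.card_filter_le _ _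

theorem hasTwoNeighbors_iff_degree_eq_two {v : V} : G.HasTwoNeighbors v ↔ G.degree v = 2 := by
  classical
  rw [← card_neighborFinset_eq_degree, Finset.card_eq_two]
  simp only [HasTwoNeighbors, Finset.ext_iff, mem_neighborFinset, Finset.mem_insert,
    Finset.mem_singleton, Ne]

theorem IsMinimalBad.two_le_degree (hℓ : 5 ≤ ℓ) (hG : IsMinimalBad (cycleCopies ℓ V) G) {v w : V}
    (h : G.Adj v w) : 2 ≤ G.degree v := by
  classical
  obtain ⟨H, hH, hHG, hvw⟩ := hG.exists_cycle h
  obtain ⟨z, hz, hvz, -⟩ := exists_second_neighbor_of_mem_cycleCopies hℓ hH hvw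
  rw [← card_neighborFinset_eq_degree, ← Finset.card_pair hz]
  refine Finset.card_le_card ?_
  simp [Finset.insert_subset_iff, h, hHG hvz]

/-- Double counting of the edges between vertices of degree two and of larger degree. -/
theorem IsMinimalBad.sum_card_degreeTwoNeighbors (hℓ : 5 ≤ ℓ)
    (hG : IsMinimalBad (cycleCopies ℓ V) G) :
    ∑ v with 3 ≤ G.degree v, (G.degreeTwoNeighbors v).card = 2 * #{v | G.degree v = 2} := by
  classical
  have h := Finset.sum_card_bipartiteAbove_eq_sum_card_bipartiteBelow
    (s := {v | 3 ≤ G.degree v}) (t := {v | G.degree v = 2}) G.Adj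
  have h1 : ∀ a ∈ ({v | G.degree v = 2} : Finset V),
      #(Finset.bipartiteBelow G.Adj {v | 3 ≤ G.degree v} a) = 2 := by
    intro a ha
    rw [Finset.mem_filter_univ] at ha
    rw [← ha, ← card_neighborFinset_eq_degree]
    congr 1
    ext x
    simp only [Finset.mem_bipartiteBelow, Finset.mem_filter_univ, mem_neighborFinset]
    refine ⟨fun h => h.2.symm, fun h => ⟨?_, h.symm⟩⟩
    have h2 := hG.two_le_degree hℓ h.symm
    have h3 : G.degree x ≠ 2 := fun hx => hG.not_adj_of_hasTwoNeighbors hℓ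
      (hasTwoNeighbors_iff_degree_eq_two.2 ha) (hasTwoNeighbors_iff_degree_eq_two.2 hx) h
    omega
  rw [Finset.sum_congr rfl h1, Finset.sum_const, smul_eq_mul, mul_comm] at h
  rw [← h]
  refine Finset.sum_congr rfl fun v _ => congrArg _ ?_
  ext x
  simp [mem_degreeTwoNeighbors, and_comm]

theorem IsMinimalBad.sum_degree (hℓ : 5 ≤ ℓ) (hG : IsMinimalBad (cycleCopies ℓ V) G) :
    ∑ v, G.degree v = 2 * #{v | G.degree v = 2} + ∑ v with 3 ≤ G.degree v, G.degree v := by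
  have h1 : ∀ v, G.degree v = (if G.degree v = 2 then 2 else 0) +
      (if 3 ≤ G.degree v then G.degree v else 0) := by
    intro v
    rcases Nat.eq_zero_or_pos (G.degree v) with h | h
    · simp [h]
    · obtain ⟨w, hw⟩ := (G.degree_pos_iff_exists_adj v).1 h
      have := hG.two_le_degree hℓ hw
      split_ifs <;> omega
  rw [Finset.sum_congr rfl fun v _ => h1 v, Finset.sum_add_distrib, Finset.sum_filter]
  simp [Finset.sum_ite, mul_comm]

theorem IsMinimalBad.card_degree_pos (hℓ : 5 ≤ ℓ) (hG : IsMinimalBad (cycleCopies ℓ V) G) :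
    #{v | 0 < G.degree v} = #{v | G.degree v = 2} + #{v | 3 ≤ G.degree v} := by
  classical
  rw [← Finset.card_union_of_disjoint (by
    rw [Finset.disjoint_left]; intro v; simp; omega)]
  congr 1
  ext v
  simp only [Finset.mem_filter_univ, Finset.mem_union]
  refine ⟨fun h => ?_, by omega⟩
  obtain ⟨w, hw⟩ := (G.degree_pos_iff_exists_adj v).1 h
  have := hG.two_le_degree hℓ hw
  omega

theorem IsMinimalBad.card_degreeTwoNeighbors_le_two (hℓ : 5 ≤ ℓ)
    (hG : IsMinimalBad (cycleCopies ℓ V) G) {v : V} (hv : G.degree v = 3) :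
    #(G.degreeTwoNeighbors v) ≤ 2 := by
  classical
  by_contra! h
  have h' : G.degreeTwoNeighbors v = G.neighborFinset v := by
    refine Finset.eq_of_subset_of_card_le (Finset.filter_subset _ _) ?_
    rw [card_neighborFinset_eq_degree]; omega
  have h2 : ∀ x, G.Adj v x → G.HasTwoNeighbors x := fun x hx => by
    rw [hasTwoNeighbors_iff_degree_eq_two]
    rw [← mem_neighborFinset, ← h', mem_degreeTwoNeighbors] at hx
    exact hx.2
  rw [← card_neighborFinset_eq_degree, Finset.card_eq_three] at hv
  obtain ⟨a, b, c, hab, hac, hbc, hv⟩ := hv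
  have hv : ∀ x, G.Adj v x ↔ x = a ∨ x = b ∨ x = c := fun x => by
    rw [← mem_neighborFinset, hv]; simp
  have hva := (hv a).2 (by simp)
  have hvb := (hv b).2 (by simp)
  have hvc := (hv c).2 (by simp)
  obtain ⟨a', ha', ha⟩ := (h2 _ hva).exists_other hva.symm
  obtain ⟨b', hb', hb⟩ := (h2 _ hvb).exists_other hvb.symm
  obtain ⟨c', hc', hc⟩ := (h2 _ hvc).exists_other hvc.symm
  exact hG.not_three_two_two_two hℓ hab hac hbc ha' hb' hc' hv ha hb hc

/-- A minimal bad graph has average degree at least `5 / 2` on its nonisolated vertices. -/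
theorem IsMinimalBad.five_mul_card_le (hℓ : 5 ≤ ℓ) (hG : IsMinimalBad (cycleCopies ℓ V) G) :
    5 * #{v | 0 < G.degree v} ≤ 2 * ∑ v, G.degree v := by
  have h1 : ∀ v ∈ ({v | 3 ≤ G.degree v} : Finset V),
      #(G.degreeTwoNeighbors v) + 10 ≤ 4 * G.degree v := by
    -- for `deg v ≥ 4` the trivial bound suffices
    intro v hv
    rw [Finset.mem_filter_univ] at hv
    have h2 := card_degreeTwoNeighbors_le (G := G) v
    rcases hv.eq_or_lt with h | h
    · have := hG.card_degreeTwoNeighbors_le_two hℓ h.symm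
      omega
    · omega
  have h2 := Finset.sum_le_sum h1
  rw [Finset.sum_add_distrib, hG.sum_card_degreeTwoNeighbors hℓ, Finset.sum_const, smul_eq_mul,
    ← Finset.mul_sum] at h2
  rw [hG.sum_degree hℓ, hG.card_degree_pos hℓ]
  omega

/-- The structure near a vertex `v` of degree three with two neighbours of degree two in a minimal
bad graph for 5-cycles: `u` is the second common neighbour of the neighbours `a`, `b` of degree
two, and has two common neighbours `x`, `y` with the third neighbour `w` of `v`. -/
def IsTwinApex (G : SimpleGraph V) (v u : V) : Prop :=
  ∃ a b w x y, [a, b, x, y].Nodup ∧ u ≠ v ∧ u ≠ w ∧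
    (∀ t, G.Adj v t ↔ t = a ∨ t = b ∨ t = w) ∧
    (∀ t, G.Adj a t ↔ t = v ∨ t = u) ∧ (∀ t, G.Adj b t ↔ t = v ∨ t = u) ∧
    G.Adj u x ∧ G.Adj w x ∧ G.Adj u y ∧ G.Adj w y

theorem IsMinimalBad.exists_isTwinApex (hG : IsMinimalBad (cycleCopies 5 V) G) {v : V}
    (hv : G.degree v = 3) (h : #(G.degreeTwoNeighbors v) = 2) : ∃ u, G.IsTwinApex v u := by
  classical
  obtain ⟨w, hw⟩ : ∃ w, G.neighborFinset v \ G.degreeTwoNeighbors v = {w} := by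
    rw [← Finset.card_eq_one, Finset.card_sdiff_of_subset
      (show G.degreeTwoNeighbors v ⊆ G.neighborFinset v from Finset.filter_subset _ _),
      card_neighborFinset_eq_degree]
    omega
  obtain ⟨a, b, hab, hs⟩ := Finset.card_eq_two.1 h
  have ha := mem_degreeTwoNeighbors.1 (show a ∈ G.degreeTwoNeighbors v by simp [hs])
  have hb := mem_degreeTwoNeighbors.1 (show b ∈ G.degreeTwoNeighbors v by simp [hs])
  have hwv : w ∈ G.neighborFinset v \ G.degreeTwoNeighbors v := by simp [hw]
  rw [Finset.mem_sdiff, hs, mem_neighborFinset] at hwv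
  have hv : ∀ t, G.Adj v t ↔ t = a ∨ t = b ∨ t = w := by
    intro t
    have h1 := Finset.ext_iff.1 hw t
    have h2 := Finset.ext_iff.1 hs t
    simp only [Finset.mem_sdiff, mem_neighborFinset, Finset.mem_singleton, Finset.mem_insert]
      at h1 h2 hwv
    grind
  obtain ⟨a', hva', ha'⟩ :=
    (hasTwoNeighbors_iff_degree_eq_two.2 ha.2).exists_other ha.1.symm
  obtain ⟨b', hvb', hb'⟩ :=
    (hasTwoNeighbors_iff_degree_eq_two.2 hb.2).exists_other hb.1.symm
  simp only [Finset.mem_insert, Finset.mem_singleton, not_or] at hwv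
  obtain ⟨rfl, h1, x, y, hxy, h2⟩ := hG.exists_of_three_two_two hab (Ne.symm hwv.2.1)
    (Ne.symm hwv.2.2) hva' hvb' hv ha' hb'
  have hwv := ((hv w).2 (by simp)).ne
  have n1 : a ≠ x := by rintro rfl; have := (ha' w).1 h2.2.1.symm; grind
  have n2 : a ≠ y := by rintro rfl; have := (ha' w).1 h2.2.2.2.symm; grind
  have n3 : b ≠ x := by rintro rfl; have := (hb' w).1 h2.2.1.symm; grind
  have n4 : b ≠ y := by rintro rfl; have := (hb' w).1 h2.2.2.2.symm; grind
  exact ⟨a', a, b, w, x, y, by simp [*], hva'.symm, h1, hv, ha', hb', h2⟩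

theorem IsTwinApex.four_le_degree {v u : V} (h : G.IsTwinApex v u) : 4 ≤ G.degree u := by
  classical
  obtain ⟨a, b, w, x, y, hnd, -, -, -, ha, hb, hux, -, huy, -⟩ := h
  have hua := ((ha u).2 (by simp)).symm
  have hub := ((hb u).2 (by simp)).symm
  rw [← card_neighborFinset_eq_degree, show 4 = [a, b, x, y].length from rfl,
    ← List.toFinset_card_of_nodup hnd]
  refine Finset.card_le_card fun t ht => ?_
  simp only [List.mem_toFinset, List.mem_cons, List.not_mem_nil, or_false] at ht
  rw [mem_neighborFinset]
  rcases ht with rfl | rfl | rfl | rfl <;> assumption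

theorem IsMinimalBad.card_degreeTwoNeighbors_ne_four (hG : IsMinimalBad (cycleCopies 5 V) G)
    {v u : V} (h : G.IsTwinApex v u) (hu : G.degree u = 4) : #(G.degreeTwoNeighbors u) ≠ 4 := by
  classical
  intro hs
  obtain ⟨a, b, w, x, y, hnd, huv, huw, hv, ha, hb, hux, hwx, huy, hwy⟩ := h
  have hua := ((ha u).2 (by simp)).symm
  have hub := ((hb u).2 (by simp)).symm
  have hN : [a, b, x, y].toFinset = G.neighborFinset u := by
    refine Finset.eq_of_subset_of_card_le (fun t ht => ?_) ?_
    · simp only [List.mem_toFinset, List.mem_cons, List.not_mem_nil, or_false] at ht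
      rw [mem_neighborFinset]
      rcases ht with rfl | rfl | rfl | rfl <;> assumption
    · rw [List.toFinset_card_of_nodup hnd, card_neighborFinset_eq_degree, hu]; rfl
  have hN' : G.degreeTwoNeighbors u = G.neighborFinset u := by
    refine Finset.eq_of_subset_of_card_le (Finset.filter_subset _ _) ?_
    rw [card_neighborFinset_eq_degree, hu, hs]
  have hu' : ∀ t, G.Adj u t ↔ t = a ∨ t = b ∨ t = x ∨ t = y := fun t => by
    rw [← mem_neighborFinset, ← hN]; simp
  have h2 : ∀ t, G.Adj u t → G.Adj w t → ∀ s, G.Adj t s ↔ s = w ∨ s = u := by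
    intro t hut hwt
    have ht : t ∈ G.degreeTwoNeighbors u := by rwa [hN', mem_neighborFinset]
    obtain ⟨r, hr, htr⟩ := (hasTwoNeighbors_iff_degree_eq_two.2
      (mem_degreeTwoNeighbors.1 ht).2).exists_other hwt.symm
    rcases (htr u).1 hut.symm with rfl | rfl
    · exact absurd rfl huw
    · exact htr
  simp only [List.nodup_cons, List.mem_cons, List.not_mem_nil, or_false, not_or] at hnd
  exact hG.not_four_two_two_two_two hnd.1.1 hnd.1.2.1 hnd.1.2.2 hnd.2.1.1 hnd.2.1.2 hnd.2.2.1
    huv huw hu' hv ha hb (h2 x hux hwx) (h2 y huy hwy)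

/-- Different vertices with the same twin apex use disjoint pairs of neighbours of degree two. -/
theorem two_mul_card_le_of_isTwinApex {u : V} (B : Finset V) (hB : ∀ v ∈ B, G.IsTwinApex v u) :
    2 * #B ≤ #(G.degreeTwoNeighbors u) := by
  classical
  rw [mul_comm, ← mul_one #(G.degreeTwoNeighbors u)]
  refine Finset.card_mul_le_card_mul (fun v a => G.Adj v a) (fun v hv => ?_) (fun a ha => ?_)
  · obtain ⟨a, b, w, x, y, hnd, huv, -, hv, ha, hb, -⟩ := hB v hv
    have hab : a ≠ b := by rintro rfl; simp at hnd
    rw [← Finset.card_pair hab]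
    refine Finset.card_le_card ?_
    have hua := ((ha u).2 (by simp)).symm
    have hub := ((hb u).2 (by simp)).symm
    have ha2 := hasTwoNeighbors_iff_degree_eq_two.1 ⟨v, u, huv.symm, ha⟩
    have hb2 := hasTwoNeighbors_iff_degree_eq_two.1 ⟨v, u, huv.symm, hb⟩
    simp [Finset.insert_subset_iff, Finset.mem_bipartiteAbove, mem_degreeTwoNeighbors, *]
  · rw [Finset.card_le_one]
    intro v hv v' hv'
    rw [Finset.mem_bipartiteBelow] at hv hv'
    obtain ⟨hua, ha⟩ := mem_degreeTwoNeighbors.1 ha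
    obtain ⟨r, hr, har⟩ := (hasTwoNeighbors_iff_degree_eq_two.2 ha).exists_other hua.symm
    have key : ∀ v ∈ B, G.Adj v a → v = r := by
      intro v hv hva
      rcases (har v).1 hva.symm with rfl | rfl
      · obtain ⟨_, _, _, _, _, -, huv, -⟩ := hB _ hv
        exact absurd rfl huv
      · rfl
    rw [key v hv.1 hv.2, key v' hv'.1 hv'.2]

/-- A minimal bad graph for 5-cycles has average degree at least `8 / 3` on its nonisolated
vertices. -/
theorem IsMinimalBad.eight_mul_card_le (hG : IsMinimalBad (cycleCopies 5 V) G) :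
    8 * #{v | 0 < G.degree v} ≤ 3 * ∑ v, G.degree v := by
  classical
  have hℓ : 5 ≤ 5 := le_rfl
  let B : Finset V := {v | G.degree v = 3 ∧ #(G.degreeTwoNeighbors v) = 2}
  have hB : ∀ v, ∃ u, v ∈ B → G.IsTwinApex v u := by
    intro v
    by_cases hv : v ∈ B
    · obtain ⟨h1, h2⟩ := (Finset.mem_filter_univ _).1 hv
      obtain ⟨u, hu⟩ := hG.exists_isTwinApex h1 h2
      exact ⟨u, fun _ => hu⟩
    · exact ⟨v, fun h => absurd h hv⟩
  choose apex hapex using hB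
  let D : Finset V := {v | 3 ≤ G.degree v}
  -- each vertex of `B` has an excess of one, which it passes on to its twin apex
  have h1 : ∀ v ∈ D, #(G.degreeTwoNeighbors v) + 8 + #{x ∈ B | apex x = v} ≤
      3 * G.degree v + if v ∈ B then 1 else 0 := by
    intro v hv
    replace hv : 3 ≤ G.degree v := by simpa [D] using hv
    have h2 := card_degreeTwoNeighbors_le (G := G) v
    have h3 := two_mul_card_le_of_isTwinApex {x ∈ B | apex x = v} (fun x hx => by
      rw [Finset.mem_filter] at hx
      exact hx.2 ▸ hapex x hx.1)
    rcases Nat.eq_zero_or_pos #{x ∈ B | apex x = v} with h0 | h0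
    · rw [h0]
      rcases hv.eq_or_lt with h | h
      · have h4 := hG.card_degreeTwoNeighbors_le_two hℓ h.symm
        split_ifs with h5
        · omega
        · have h6 : #(G.degreeTwoNeighbors v) ≠ 2 := fun h6 =>
            h5 ((Finset.mem_filter_univ _).2 ⟨h.symm, h6⟩)
          omega
      · omega
    · obtain ⟨x, hx⟩ := Finset.card_pos.1 h0
      rw [Finset.mem_filter] at hx
      have hx := hx.2 ▸ hapex x hx.1
      have h4 := hx.four_le_degree
      have h5 := hG.card_degreeTwoNeighbors_ne_four hx
      -- with `s` neighbours of degree two, `v` receives at most `⌊s / 2⌋`, and `s ≤ deg v`; thus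
      -- `s + ⌊s / 2⌋ + 8 ≤ 3 * deg v` can fail only for `s = deg v = 4`
      omega
  have h2 := Finset.sum_le_sum h1
  have h3 : ∑ v ∈ D, #{x ∈ B | apex x = v} = #B := by
    refine (Finset.card_eq_sum_card_fiberwise fun x hx => ?_).symm
    have := (hapex x hx).four_le_degree
    exact (Finset.mem_filter_univ _).2 (by omega)
  have h4 : (∑ v ∈ D, if v ∈ B then 1 else 0) ≤ #B := by
    rw [← Finset.card_filter]
    exact Finset.card_le_card fun x hx => (Finset.mem_filter.1 hx).2
  rw [Finset.sum_add_distrib, Finset.sum_add_distrib, Finset.sum_add_distrib, h3,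
    hG.sum_card_degreeTwoNeighbors hℓ, Finset.sum_const, smul_eq_mul, ← Finset.mul_sum] at h2
  rw [hG.sum_degree hℓ, hG.card_degree_pos hℓ]
  simp only [D] at h2 h4
  omega

end Discharging

/-! ### From maximum density to average degree -/

/-- A graph without good colouring contains an edge-minimal one. -/
theorem exists_isMinimalBad [Finite V] {𝒞 : Set (SimpleGraph V)} {G : SimpleGraph V}
    (hG : ¬ HasGoodColoring 𝒞 G) : ∃ G' ≤ G, IsMinimalBad 𝒞 G' := by
  obtain ⟨G', hle, hG'⟩ := exists_minimal_le_of_wellFoundedLT (¬ HasGoodColoring 𝒞 ·) G hG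
  refine ⟨G', hle, hG'.prop, fun K hK => ?_⟩
  by_contra h
  exact hK.not_ge (hG'.le_of_le h hK.le)

/-- The definition of `maxDensity`, applied to the subgraph formed by the edges of `G'` and the
vertices that they cover. -/
theorem sum_degree_le_maxDensity_mul [Fintype V] {G G' : SimpleGraph V} [DecidableRel G'.Adj]
    (hle : G' ≤ G) :
    (∑ v, (G'.degree v : ℝ)) ≤ 2 * G.maxDensity * #{v | 0 < G'.degree v} := by
  classical
  rcases Nat.eq_zero_or_pos #{v | 0 < G'.degree v} with h0 | h0
  · have : ∀ v, G'.degree v = 0 := fun v => by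
      rw [Finset.card_eq_zero, Finset.filter_eq_empty_iff] at h0
      have := h0 (Finset.mem_univ v)
      omega
    simp [this]
  obtain ⟨v₀, -⟩ := Finset.card_pos.1 h0
  have : Nonempty V := ⟨v₀⟩
  let J : G.Subgraph :=
    { verts := {v | 0 < G'.degree v}
      Adj := G'.Adj
      adj_sub := fun h => hle h
      edge_vert := fun {v w} h => (G'.degree_pos_iff_exists_adj v).2 ⟨w, h⟩
      symm := G'.symm }
  have hv : J.verts.ncard = #{v | 0 < G'.degree v} := by
    rw [← Set.ncard_coe_finset]
    congr 1
    ext v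
    simp [J]
  have he : J.edgeSet.ncard = #G'.edgeFinset := by
    rw [← Set.ncard_coe_finset, coe_edgeFinset]
    congr 1
  have h := (isGreatest_maxDensity G).2 ⟨J, by omega, rfl⟩
  rw [hv, he, div_le_iff₀ (by exact_mod_cast h0)] at h
  have h2 : (∑ v, (G'.degree v : ℝ)) = 2 * #G'.edgeFinset := by
    exact_mod_cast G'.sum_degrees_eq_twice_card_edges
  rw [h2]
  linarith

theorem IsMinimalBad.exists_degree_pos [Fintype V] {ℓ : ℕ} (hℓ : 5 ≤ ℓ) {G : SimpleGraph V}
    [DecidableRel G.Adj] (hG : IsMinimalBad (cycleCopies ℓ V) G) : 0 < #{v | 0 < G.degree v} := by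
  obtain ⟨x, y, h⟩ : ∃ x y, G.Adj x y := by
    by_contra! hno
    refine hG.1 ⟨fun _ => 0, fun p x y h => absurd h (hno p x), ?_⟩
    rintro H ⟨f, rfl⟩ hH
    obtain ⟨n, rfl⟩ : ∃ n, ℓ = n + 2 := ⟨ℓ - 2, by omega⟩
    have : (cycleGraph (n + 2)).Adj 1 0 := by simp [cycleGraph_adj]
    exact absurd (hH ((map_adj_apply (f := f)).2 this)) (hno _ _)
  exact Finset.card_pos.2 ⟨x, (Finset.mem_filter_univ _).2
    ((G.degree_pos_iff_exists_adj x).2 ⟨y, h⟩)⟩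

theorem hasGoodColoring_of_maxDensity_lt [Finite V] (G : SimpleGraph V) {ℓ : ℕ} (hℓ : 5 ≤ ℓ)
    (hG : G.maxDensity < ((ℓ : ℝ) - 1) / ((ℓ : ℝ) - 2)) :
    HasGoodColoring (cycleCopies ℓ V) G := by
  classical
  have := Fintype.ofFinite V
  by_contra hbad
  obtain ⟨G', hle, hmin⟩ := exists_isMinimalBad hbad
  have hpos : (0 : ℝ) < #{v | 0 < G'.degree v} := by exact_mod_cast hmin.exists_degree_pos hℓ
  have hsum := sum_degree_le_maxDensity_mul hle
  rcases hℓ.eq_or_lt with rfl | hℓ'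
  · have h : (8 : ℝ) * #{v | 0 < G'.degree v} ≤ 3 * ∑ v, (G'.degree v : ℝ) := by
      exact_mod_cast hmin.eight_mul_card_le
    norm_num at hG
    nlinarith
  · have h : (5 : ℝ) * #{v | 0 < G'.degree v} ≤ 2 * ∑ v, (G'.degree v : ℝ) := by
      exact_mod_cast hmin.five_mul_card_le hℓ
    have hℓ6 : (6 : ℝ) ≤ ℓ := by exact_mod_cast hℓ'
    have : ((ℓ : ℝ) - 1) / ((ℓ : ℝ) - 2) ≤ 5 / 4 := by
      rw [div_le_div_iff₀ (by linarith) (by norm_num)]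
      linarith
    nlinarith

end SimpleGraph

theorem lemma2p2 {V : Type*} [Finite V] (G : SimpleGraph V) (ℓ : ℕ) (hℓ : 5 ≤ ℓ)
    (hG : G.maxDensity < ((ℓ : ℝ) - 1) / ((ℓ : ℝ) - 2)) :
    ¬ G.AntiRamsey (SimpleGraph.cycleGraph ℓ) :=
  SimpleGraph.not_antiRamsey_of_hasGoodColoring
    (SimpleGraph.hasGoodColoring_of_maxDensity_lt G hℓ hG)
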